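/- Let $\ell\geq 1$ and $h\geq 0$ be integers, and let $\Gamma$ be an abelian group of order $16(2\ell+1)(2h+1)$. A $\Gamma$-magic rectangle set $\mathrm{MRS}_\Gamma(2\ell+1,8;4h+2)$ is a collection of $4h+2$ arrays of size $(2\ell+1)\times 8$ with entries in $\Gamma$, such that every element of $\Gamma$ appears exactly once and in a unique array, and there are constants $\omega,\delta\in\Gamma$ such that the elements of each row of each array sum to $\omega$ and the elements of each column of each array sum to $\delta$. Then an $\mathrm{MRS}_\Gamma(2\ell+1,8;4h+2)$ exists if and only if $\Gamma$ has more than one involution, that is, more than one element of order $2$. -/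

import Mathlib

/-- A `Γ`-magic rectangle set `MRS_Γ(a, b; c)`: a collection of `c` arrays of size `a × b` with
entries in the abelian group `Γ`. The entry of the `k`-th array in row `i` and column `j` is
`entry (k, i, j)`. Every element of `Γ` appears exactly once in the whole collection (so `Γ` has
order `a * b * c`), all rows of all arrays have the same sum `ω`, and all columns of all arrays
have the same sum `δ`. -/
structure MagicRectangleSet (Γ : Type*) [AddCommGroup Γ] (a b c : ℕ) where
  entry : Fin c × Fin a × Fin b → Γ
  entry_bijective : Function.Bijective entry
  ω : Γ
  δ : Γ
  row_sum : ∀ (k : Fin c) (i : Fin a), ∑ j : Fin b, entry (k, i, j) = ω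
  col_sum : ∀ (k : Fin c) (j : Fin b), ∑ i : Fin a, entry (k, i, j) = δ

/-- The set of involutions (elements of order exactly two) of an additive group. -/
def involutions (Γ : Type*) [AddGroup Γ] : Set Γ := {g | addOrderOf g = 2}

/-! Necessity: if `i` is the only involution, pairing `x` with `-x` shows that all elements of `Γ`
sum to `i`. Adding up columns shows that the sum is `(4h+2)·8·δ`, so multiplying by `2ℓ+1` gives
`(2ℓ+1)i = |Γ|δ = 0`, impossible for an element of order two.

Sufficiency: write `Γ = P × O` with `|P| = 16` and `|O|` odd, and take `H ≤ O` of order `2h+1`,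
hence of index `2ℓ+1`. There is one array for each of two labels and each `t ∈ H`, with rows indexed
essentially by `O ⧸ H`. The row of a class `c` fills half its columns from `c` and half from `-c`,
and the row of `-c` is its negative, so such pairs add nothing to column sums. The class `0` is its
own negative and has no partner; it is therefore merged with one pair `r`, `-r` into a separate
block of three rows. All line sums are then zero. What remains is finite data on `P`, found
explicitly for each noncyclic abelian group of order sixteen. -/

/-! ### Finite tables over the noncyclic groups of order sixteen -/

/-- The balanced signs attached to the eight columns. -/
def colSign : Fin 8 → ℤ := ![1, 1, 1, 1, -1, -1, -1, -1]

/-- A balanced `3 × 8` table each of whose columns is a permutation of `0, 1, -1`. -/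
def rowSign : Fin 3 → Fin 8 → ℤ :=
  ![![0, 0, 1, -1, 1, -1, 0, 0], ![1, -1, 0, 0, -1, 1, 1, -1], ![-1, 1, -1, 1, 0, 0, -1, 1]]

/-- A `3 × 8` table of nonzero multipliers whose line sums vanish. -/
def shiftCoeff : Fin 3 → Fin 8 → ℤ := fun i j => ![1, 1, -2] i * colSign j

/-- Tables over a group `P` of order sixteen from which magic rectangles over `P × O`, `O` of odd
order, are assembled. `x` lists `P` in two rows of eight whose alternating sums vanish; `p` lists
three copies of `P`, told apart by `rowSign`, in two `3 × 8` arrays with vanishing line sums. -/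
structure TwoGroupPattern (P : Type*) [AddCommGroup P] where
  x : Fin 2 → Fin 8 → P
  p : Fin 2 → Fin 3 → Fin 8 → P
  x_inj : ∀ e j e' j', x e j = x e' j' → e = e' ∧ j = j'
  p_inj : ∀ e i j e' i' j', p e i j = p e' i' j' → rowSign i j = rowSign i' j' →
    e = e' ∧ i = i' ∧ j = j'
  x_sum : ∀ e, ∑ j, colSign j • x e j = 0
  p_row_sum : ∀ e i, ∑ j, p e i j = 0
  p_col_sum : ∀ e j, ∑ i, p e i j = 0

/-- Transport of a pattern along an isomorphism. -/
def TwoGroupPattern.map {P P' : Type*} [AddCommGroup P] [AddCommGroup P'] (T : TwoGroupPattern P)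
    (f : P ≃+ P') : TwoGroupPattern P' where
  x e j := f (T.x e j)
  p e i j := f (T.p e i j)
  x_inj e j e' j' h := T.x_inj e j e' j' (f.injective h)
  p_inj e i j e' i' j' h := T.p_inj e i j e' i' j' (f.injective h)
  x_sum e := by simp only [← map_zsmul, ← map_sum, T.x_sum, map_zero]
  p_row_sum e i := by simp only [← map_sum, T.p_row_sum, map_zero]
  p_col_sum e j := by simp only [← map_sum, T.p_col_sum, map_zero]

/-- A pattern over `ZMod 2 × ZMod 8`. -/
def TwoGroupPattern.twoEight : TwoGroupPattern (ZMod 2 × ZMod 8) where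
  x := ![![(1, 2), (0, 5), (1, 5), (1, 0), (1, 7), (0, 1), (1, 1), (1, 3)],
    ![(1, 4), (1, 6), (0, 2), (0, 4), (0, 6), (0, 7), (0, 0), (0, 3)]]
  p :=
    ![![![(0, 6), (1, 2), (1, 2), (1, 5), (0, 2), (0, 4), (0, 0), (1, 3)],
      ![(1, 3), (1, 0), (1, 4), (0, 5), (0, 3), (1, 7), (0, 1), (0, 1)],
      ![(1, 7), (0, 6), (0, 2), (1, 6), (0, 3), (1, 5), (0, 7), (1, 4)]],
     ![![(1, 0), (1, 6), (0, 7), (0, 6), (1, 5), (0, 0), (1, 1), (0, 7)],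
      ![(0, 5), (1, 6), (0, 4), (0, 2), (1, 2), (1, 1), (0, 3), (1, 1)],
      ![(1, 3), (0, 4), (0, 5), (0, 0), (0, 1), (1, 7), (1, 4), (1, 0)]]]
  x_inj := by decide +kernel
  p_inj := by decide +kernel
  x_sum := by decide +kernel
  p_row_sum := by decide +kernel
  p_col_sum := by decide +kernel

/-- A pattern over `ZMod 4 × ZMod 4`. -/
def TwoGroupPattern.fourFour : TwoGroupPattern (ZMod 4 × ZMod 4) where
  x := ![![(2, 1), (0, 0), (2, 3), (0, 3), (3, 2), (2, 2), (2, 0), (1, 3)],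
    ![(1, 0), (3, 0), (1, 2), (1, 1), (3, 1), (0, 1), (3, 3), (0, 2)]]
  p :=
    ![![![(3, 2), (3, 1), (0, 2), (0, 2), (0, 3), (2, 1), (0, 0), (0, 1)],
      ![(1, 2), (0, 3), (2, 3), (2, 2), (1, 2), (3, 3), (2, 2), (1, 3)],
      ![(0, 0), (1, 0), (2, 3), (2, 0), (3, 3), (3, 0), (2, 2), (3, 0)]],
     ![![(2, 1), (1, 3), (0, 0), (3, 1), (2, 1), (1, 1), (2, 0), (1, 1)],
      ![(1, 3), (3, 0), (1, 2), (0, 2), (2, 0), (2, 3), (3, 1), (0, 1)],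
      ![(1, 0), (0, 1), (3, 2), (1, 1), (0, 3), (1, 0), (3, 3), (3, 2)]]]
  x_inj := by decide +kernel
  p_inj := by decide +kernel
  x_sum := by decide +kernel
  p_row_sum := by decide +kernel
  p_col_sum := by decide +kernel

/-- A pattern over `ZMod 2 × ZMod 2 × ZMod 4`. -/
def TwoGroupPattern.twoTwoFour : TwoGroupPattern (ZMod 2 × ZMod 2 × ZMod 4) where
  x := ![![(0, 1, 2), (0, 0, 3), (1, 0, 3), (0, 1, 1), (1, 0, 2), (1, 1, 2), (1, 0, 1), (0, 1, 0)],
    ![(0, 1, 3), (1, 1, 1), (0, 0, 1), (0, 0, 2), (1, 0, 0), (0, 0, 0), (1, 1, 0), (1, 1, 3)]]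
  p :=
    ![![![(1, 1, 2), (0, 0, 3), (1, 1, 2), (1, 0, 0), (0, 0, 2), (1, 1, 3), (0, 0, 2), (0, 1, 2)],
      ![(1, 0, 3), (0, 1, 1), (1, 0, 2), (0, 1, 0), (0, 0, 2), (0, 0, 0), (0, 0, 1), (0, 0, 3)],
      ![(0, 1, 3), (0, 1, 0), (0, 1, 0), (1, 1, 0), (0, 0, 0), (1, 1, 1), (0, 0, 1), (0, 1, 3)]],
     ![![(1, 0, 3), (0, 1, 3), (0, 1, 1), (1, 0, 1), (0, 1, 2), (0, 0, 0), (0, 0, 1), (0, 1, 1)],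
      ![(1, 1, 3), (1, 1, 0), (1, 0, 1), (1, 0, 0), (1, 0, 2), (1, 1, 1), (1, 0, 0), (1, 1, 1)],
      ![(0, 1, 2), (1, 0, 1), (1, 1, 2), (0, 0, 3), (1, 1, 0), (1, 1, 3), (1, 0, 3), (1, 0, 2)]]]
  x_inj := by decide +kernel
  p_inj := by decide +kernel
  x_sum := by decide +kernel
  p_row_sum := by decide +kernel
  p_col_sum := by decide +kernel

/-- A pattern over `ZMod 2 × ZMod 2 × ZMod 2 × ZMod 2`. -/
def TwoGroupPattern.twoTwoTwoTwo : TwoGroupPattern (ZMod 2 × ZMod 2 × ZMod 2 × ZMod 2) where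
  x := ![![(0, 1, 1, 1), (0, 0, 0, 0), (0, 0, 1, 1), (1, 1, 1, 0),
      (0, 0, 0, 1), (0, 1, 1, 0), (0, 1, 0, 1), (1, 0, 0, 0)],
    ![(1, 1, 1, 1), (1, 0, 0, 1), (1, 0, 1, 1), (1, 1, 0, 1),
      (1, 1, 0, 0), (0, 0, 1, 0), (0, 1, 0, 0), (1, 0, 1, 0)]]
  p :=
    ![![![(1, 1, 1, 0), (1, 0, 1, 0), (0, 0, 1, 0), (0, 1, 0, 1), (0, 0, 1, 1), (1, 0, 0, 0), (1, 1, 0, 1), (0, 1, 0, 1)],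
      ![(0, 1, 0, 0), (0, 0, 1, 0), (0, 0, 0, 1), (1, 0, 0, 1), (0, 1, 0, 0), (0, 0, 0, 0), (0, 0, 0, 1), (1, 0, 1, 1)],
      ![(1, 0, 1, 0), (1, 0, 0, 0), (0, 0, 1, 1), (1, 1, 0, 0), (0, 1, 1, 1), (1, 0, 0, 0), (1, 1, 0, 0), (1, 1, 1, 0)]],
     ![![(1, 1, 1, 1), (0, 1, 1, 0), (0, 1, 0, 1), (0, 0, 0, 0), (1, 1, 0, 1), (1, 1, 0, 1), (0, 0, 0, 0), (1, 1, 0, 0)],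
      ![(0, 1, 1, 0), (0, 0, 0, 1), (0, 0, 1, 0), (1, 0, 1, 1), (1, 1, 1, 0), (1, 0, 0, 1), (1, 1, 1, 1), (0, 1, 1, 0)],
      ![(1, 0, 0, 1), (0, 1, 1, 1), (0, 1, 1, 1), (1, 0, 1, 1), (0, 0, 1, 1), (0, 1, 0, 0), (1, 1, 1, 1), (1, 0, 1, 0)]]]
  x_inj := by decide +kernel
  p_inj := by decide +kernel
  x_sum := by decide +kernel
  p_row_sum := by decide +kernel
  p_col_sum := by decide +kernel

/-! ### Necessity: the sum of all elements -/

/-- If a finite abelian group has a unique involution, its elements sum to that involution. -/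
theorem sum_eq_of_unique_involution {Γ : Type*} [AddCommGroup Γ] [Fintype Γ] [DecidableEq Γ]
    {i : Γ} (hi : addOrderOf i = 2) (huniq : ∀ x : Γ, addOrderOf x = 2 → x = i) :
    ∑ x : Γ, x = i := by
  have h2 : i + i = 0 := by rw [← two_nsmul, ← hi, addOrderOf_nsmul_eq_zero]
  have hni : -i = i := by rw [neg_eq_iff_add_eq_zero, h2]
  rw [← Finset.add_sum_erase _ _ (Finset.mem_univ i)]
  rw [add_eq_left]
  -- A nonzero fixed point of negation is an involution, hence the erased element `i`.
  refine Finset.sum_involution (fun x _ => -x) (by simp) ?_ ?_ (by simp)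
  · intro x hx hx0 hxx
    refine (Finset.mem_erase.1 hx).1 (huniq x (addOrderOf_eq_prime ?_ hx0))
    rw [two_nsmul]
    nth_rewrite 1 [← hxx]
    simp
  · intro x hx
    simp only [Finset.mem_erase, Finset.mem_univ, and_true] at hx ⊢
    rw [← hni]
    simpa using hx

theorem one_lt_ncard_involutions {ℓ h : ℕ} {Γ : Type*} [AddCommGroup Γ]
    (hΓ : Nat.card Γ = 16 * (2 * ℓ + 1) * (2 * h + 1))
    (M : MagicRectangleSet Γ (2 * ℓ + 1) 8 (4 * h + 2)) : 1 < (involutions Γ).ncard := by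
  classical
  have : Finite Γ := Nat.finite_of_card_ne_zero (by rw [hΓ]; positivity)
  have := Fintype.ofFinite Γ
  by_contra! hle
  obtain ⟨i, hi⟩ := exists_prime_addOrderOf_dvd_card' (G := Γ) 2 (by
    rw [hΓ]; exact ⟨8 * (2 * ℓ + 1) * (2 * h + 1), by ring⟩)
  have huniq : ∀ x : Γ, addOrderOf x = 2 → x = i := fun x hx =>
    (Set.ncard_le_one (Set.toFinite _)).1 hle x hx i hi
  have hsum : ∑ x : Γ, x = ((4 * h + 2) * 8) • M.δ := by
    rw [← M.entry_bijective.sum_comp (fun x => x), Fintype.sum_prod_type]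
    simp_rw [Fintype.sum_prod_type_right, M.col_sum]
    simp [mul_smul]
  rw [sum_eq_of_unique_involution hi huniq] at hsum
  have h0 : (2 * ℓ + 1) • i = 0 := by
    rw [hsum, ← mul_smul, show (2 * ℓ + 1) * ((4 * h + 2) * 8) = Nat.card Γ by rw [hΓ]; ring]
    exact card_nsmul_eq_zero'
  have := addOrderOf_dvd_of_nsmul_eq_zero h0
  rw [hi] at this
  omega

/-! ### Subgroups and the splitting into 2-part and odd part -/

/-- A finite abelian group has a subgroup of every order dividing its own. -/
theorem AddCommGroup.exists_addSubgroup_card (n : ℕ) :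
    ∀ {O : Type*} [AddCommGroup O] [Finite O], n ∣ Nat.card O →
      ∃ H : AddSubgroup O, Nat.card H = n := by
  induction n using Nat.strong_induction_on with
  | _ n ih =>
  intro O _ _ hn
  by_cases h1 : n = 1
  · exact ⟨⊥, by simp [h1]⟩
  obtain ⟨p, hp, k, rfl⟩ := Nat.exists_prime_and_dvd h1
  have := Fact.mk hp
  have hpos : 0 < p * k := Nat.pos_of_dvd_of_pos hn Nat.card_pos
  have hk : k < p * k := by nlinarith [hp.two_le, Nat.pos_of_mul_pos_left hpos]
  obtain ⟨g, hg⟩ := exists_prime_addOrderOf_dvd_card' (G := O) p ((dvd_mul_right p k).trans hn)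
  -- Quotient by a subgroup of prime order `p`, then pull back a subgroup of order `k`.
  set Z := AddSubgroup.zmultiples g
  have hZ : Nat.card Z = p := by rw [Nat.card_zmultiples, hg]
  have hcard := AddSubgroup.card_eq_card_quotient_mul_card_addSubgroup Z
  have hdvd : k ∣ Nat.card (O ⧸ Z) := by
    rw [hcard, hZ, mul_comm] at hn
    exact Nat.dvd_of_mul_dvd_mul_right hp.pos hn
  obtain ⟨K, hK⟩ := ih k hk hdvd
  refine ⟨K.comap (QuotientAddGroup.mk' Z), ?_⟩
  have hi := K.index_comap_of_surjective (QuotientAddGroup.mk'_surjective Z)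
  have hK1 := K.card_mul_index
  have hK2 := (K.comap (QuotientAddGroup.mk' Z)).card_mul_index
  rw [hi, hcard, hZ, ← hK1, hK] at hK2
  have : 0 < K.index := Nat.pos_of_ne_zero K.index_ne_zero_of_finite
  refine Nat.eq_of_mul_eq_mul_right this (hK2.trans (by ring))

/-- The kernel of multiplication by `n`. -/
def nsmulKer (G : Type*) [AddCommGroup G] (n : ℕ) : AddSubgroup G := (nsmulAddMonoidHom n).ker

@[simp] theorem mem_nsmulKer {G : Type*} [AddCommGroup G] {n : ℕ} {x : G} :
    x ∈ nsmulKer G n ↔ n • x = 0 := AddMonoidHom.mem_ker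

/-- Primary decomposition with respect to a coprime factorisation of an exponent. -/
theorem nonempty_prod_nsmulKer_equiv {G : Type*} [AddCommGroup G] {a b : ℕ} (hab : a.Coprime b)
    (h : ∀ x : G, (a * b) • x = 0) : Nonempty (nsmulKer G a × nsmulKer G b ≃+ G) := by
  refine ⟨AddEquiv.ofBijective
    ((nsmulKer G a).subtype.coprod (nsmulKer G b).subtype) ⟨?_, ?_⟩⟩
  · rw [injective_iff_map_eq_zero]
    rintro ⟨⟨x, hx⟩, ⟨y, hy⟩⟩ hxy
    rw [mem_nsmulKer] at hx hy
    have hxy : x + y = 0 := hxy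
    obtain rfl := eq_neg_of_add_eq_zero_left hxy
    have hya : a • y = 0 := by simpa using hx
    have : y = 0 := by
      have := Nat.dvd_gcd (addOrderOf_dvd_of_nsmul_eq_zero hya) (addOrderOf_dvd_of_nsmul_eq_zero hy)
      rw [hab.gcd_eq_one, Nat.dvd_one] at this
      exact AddMonoid.addOrderOf_eq_one_iff.1 this
    simp [this]
  · intro x
    have hbz : (1 : ℤ) = a * a.gcdA b + b * a.gcdB b := by
      rw [← Nat.gcd_eq_gcd_ab, hab.gcd_eq_one, Nat.cast_one]
    refine ⟨⟨⟨(b * a.gcdB b : ℤ) • x, ?_⟩, ⟨(a * a.gcdA b : ℤ) • x, ?_⟩⟩, ?_⟩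
    · rw [mem_nsmulKer, ← natCast_zsmul, ← mul_smul,
        show (a : ℤ) * (b * a.gcdB b) = a.gcdB b * (a * b : ℕ) by push_cast; ring, mul_smul,
        natCast_zsmul, h, smul_zero]
    · rw [mem_nsmulKer, ← natCast_zsmul, ← mul_smul,
        show (b : ℤ) * (a * a.gcdA b) = a.gcdA b * (a * b : ℕ) by push_cast; ring, mul_smul,
        natCast_zsmul, h, smul_zero]
    · change (b * a.gcdB b : ℤ) • x + (a * a.gcdA b : ℤ) • x = x
      rw [← add_smul, add_comm, ← hbz, one_smul]

/-- By Cauchy, every prime dividing the order of the `n`-torsion divides `n`. Hence each of the two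
orders divides its own factor, and their product leaves no room for strict inequality. -/
theorem card_nsmulKer_two_pow {G : Type*} [AddCommGroup G] {k b : ℕ} (hb : Odd b)
    (hG : Nat.card G = 2 ^ k * b) :
    Nat.card (nsmulKer G (2 ^ k)) = 2 ^ k ∧ Nat.card (nsmulKer G b) = b := by
  have : Finite G := Nat.finite_of_card_ne_zero (by
    rw [hG]; exact mul_ne_zero (by positivity) hb.pos.ne')
  have hcop : (2 ^ k).Coprime b := (Nat.coprime_two_left.2 hb).pow_left k
  obtain ⟨f⟩ := nonempty_prod_nsmulKer_equiv (G := G) hcop (fun x => by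
    rw [← hG]; exact card_nsmul_eq_zero')
  have hcard := (Nat.card_congr f.toEquiv).symm
  rw [Nat.card_prod, hG] at hcard
  have hP : ∀ p : ℕ, p.Prime → ∀ n : ℕ, p ∣ Nat.card (nsmulKer G n) → p ∣ n := by
    intro p hp n hpn
    have := Fact.mk hp
    obtain ⟨g, hg⟩ := exists_prime_addOrderOf_dvd_card' (G := nsmulKer G n) p hpn
    rw [← hg]
    exact addOrderOf_dvd_of_nsmul_eq_zero (Subtype.ext (mem_nsmulKer.1 g.2))
  have hcop' : ∀ n m : ℕ, n.Coprime m → (Nat.card (nsmulKer G n)).Coprime m := fun n m hnm =>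
    Nat.coprime_of_dvd fun p hp h1 h2 =>
      hp.one_lt.ne' (Nat.dvd_one.1 (hnm ▸ Nat.dvd_gcd (hP p hp n h1) h2))
  have h1 : Nat.card (nsmulKer G (2 ^ k)) ∣ 2 ^ k :=
    (hcop' _ _ hcop).dvd_of_dvd_mul_right (hcard ▸ dvd_mul_right _ _)
  have h2 : Nat.card (nsmulKer G b) ∣ b :=
    (hcop' _ _ hcop.symm).dvd_of_dvd_mul_left (hcard ▸ dvd_mul_left _ _)
  have e1 := Nat.le_of_dvd (by positivity) h1
  have e2 := Nat.le_of_dvd hb.pos h2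
  have p1 : 0 < 2 ^ k := by positivity
  have p2 := hb.pos
  constructor <;> nlinarith

/-! ### Classification of the noncyclic groups of order sixteen -/

/-- Splitting off the first factor of a finite product. -/
def finConsAddEquiv {k : ℕ} (M : Fin (k + 1) → Type*) [∀ i, AddCommGroup (M i)] :
    (∀ i, M i) ≃+ M 0 × ∀ i : Fin k, M i.succ :=
  (Fin.consLinearEquiv ℤ M).symm.toAddEquiv

theorem nonempty_pi_fin_two_equiv (n : Fin 2 → ℕ) {a b : ℕ} (ha : n 0 = a) (hb : n 1 = b) :
    Nonempty ((∀ i, ZMod (n i)) ≃+ ZMod a × ZMod b) := by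
  subst ha hb
  exact ⟨(RingEquiv.piFinTwo fun i => ZMod (n i)).toAddEquiv⟩

theorem nonempty_pi_fin_three_equiv (n : Fin 3 → ℕ) {a b c : ℕ} (ha : n 0 = a) (hb : n 1 = b)
    (hc : n 2 = c) : Nonempty ((∀ i, ZMod (n i)) ≃+ ZMod a × ZMod b × ZMod c) := by
  subst ha
  obtain ⟨f⟩ := nonempty_pi_fin_two_equiv (fun i => n i.succ) hb hc
  exact ⟨(finConsAddEquiv fun i => ZMod (n i)).trans ((AddEquiv.refl _).prodCongr f)⟩

theorem nonempty_pi_fin_four_equiv (n : Fin 4 → ℕ) {a b c d : ℕ} (ha : n 0 = a) (hb : n 1 = b)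
    (hc : n 2 = c) (hd : n 3 = d) :
    Nonempty ((∀ i, ZMod (n i)) ≃+ ZMod a × ZMod b × ZMod c × ZMod d) := by
  subst ha
  obtain ⟨f⟩ := nonempty_pi_fin_three_equiv (fun i => n i.succ) hb hc hd
  exact ⟨(finConsAddEquiv fun i => ZMod (n i)).trans ((AddEquiv.refl _).prodCongr f)⟩

/-- The structure theorem with factors indexed by an initial segment of `ℕ`. -/
theorem exists_equiv_pi_fin_zmod (G : Type*) [AddCommGroup G] [Finite G] :
    ∃ (k : ℕ) (n : Fin k → ℕ), (∀ i, 1 < n i) ∧ ∏ i, n i = Nat.card G ∧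
      Nonempty (G ≃+ ∀ i, ZMod (n i)) := by
  classical
  obtain ⟨ι, _, n, hn, ⟨f⟩⟩ := AddCommGroup.equiv_directSum_zmod_of_finite' G
  let g := (Fintype.equivFin ι).symm
  let f' := (f.trans (DirectSum.addEquivProd _)).trans
    (RingEquiv.piCongrLeft (fun i => ZMod (n i)) g).symm.toAddEquiv
  refine ⟨_, fun i => n (g i), fun i => hn _, ?_, ⟨f'⟩⟩
  rw [Nat.card_congr f'.toEquiv, Nat.card_pi]
  simp

theorem not_cyclic_of_two_involutions {P : Type*} [AddCommGroup P]
    (hinv : ∃ u v : P, u ≠ v ∧ addOrderOf u = 2 ∧ addOrderOf v = 2) (f : P ≃+ ZMod 16) : False := by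
  obtain ⟨u, v, huv, hu, hv⟩ := hinv
  have key : ∀ a : ZMod 16, 2 • a = 0 → a ≠ 0 → a = 8 := by decide
  have h8 : ∀ w : P, addOrderOf w = 2 → f w = 8 := fun w hw => by
    refine key _ ?_ ?_
    · rw [← map_nsmul, ← hw, addOrderOf_nsmul_eq_zero, map_zero]
    · rw [Ne, map_eq_zero_iff f f.injective]
      rintro rfl
      simp at hw
  exact huv (f.injective ((h8 u hu).trans (h8 v hv).symm))

/-- Every noncyclic abelian group of order sixteen carries a pattern. -/
theorem nonempty_twoGroupPattern {P : Type*} [AddCommGroup P] (hP : Nat.card P = 16)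
    (hinv : ∃ u v : P, u ≠ v ∧ addOrderOf u = 2 ∧ addOrderOf v = 2) :
    Nonempty (TwoGroupPattern P) := by
  have : Finite P := Nat.finite_of_card_ne_zero (by rw [hP]; norm_num)
  obtain ⟨k, n, hn, hprod, ⟨f⟩⟩ := exists_equiv_pi_fin_zmod P
  rw [hP] at hprod
  have hdvd (i) : n i = 2 ∨ n i = 4 ∨ n i = 8 ∨ n i = 16 := by
    have h1 : n i ∈ Nat.divisors 16 :=
      Nat.mem_divisors.2 ⟨hprod ▸ Finset.dvd_prod_of_mem n (Finset.mem_univ i), by norm_num⟩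
    have h2 : ∀ d ∈ Nat.divisors 16, 1 < d → d = 2 ∨ d = 4 ∨ d = 8 ∨ d = 16 := by decide
    exact h2 _ h1 (hn i)
  have hle : k ≤ 4 := by
    have hcard : 2 ^ k ≤ 16 := by
      rw [← hprod, show 2 ^ k = ∏ _i : Fin k, 2 by simp]
      exact Finset.prod_le_prod' fun i _ => hn i
    exact (Nat.pow_le_pow_iff_right (by norm_num : 1 < 2)).1 hcard
  suffices Nonempty (TwoGroupPattern (∀ i, ZMod (n i))) from this.map fun T => T.map f.symm
  interval_cases k
  · simp at hprod
  · have h0 : n 0 = 16 := by simpa using hprod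
    have e := (RingEquiv.piUnique fun i => ZMod (n i)).toAddEquiv
    rw [show n default = 16 from h0] at e
    exact (not_cyclic_of_two_involutions hinv (f.trans e)).elim
  · rw [Fin.prod_univ_two] at hprod
    rcases hdvd 0 with h0 | h0 | h0 | h0 <;> rcases hdvd 1 with h1 | h1 | h1 | h1 <;>
      rw [h0, h1] at hprod <;> norm_num at hprod <;>
      obtain ⟨e⟩ := nonempty_pi_fin_two_equiv n h0 h1
    · exact ⟨TwoGroupPattern.twoEight.map e.symm⟩
    · exact ⟨TwoGroupPattern.fourFour.map e.symm⟩
    · exact ⟨TwoGroupPattern.twoEight.map (AddEquiv.prodComm.trans e.symm)⟩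
  · rw [Fin.prod_univ_three] at hprod
    rcases hdvd 0 with h0 | h0 | h0 | h0 <;> rcases hdvd 1 with h1 | h1 | h1 | h1 <;>
      rcases hdvd 2 with h2 | h2 | h2 | h2 <;>
      rw [h0, h1, h2] at hprod <;> norm_num at hprod <;>
      obtain ⟨e⟩ := nonempty_pi_fin_three_equiv n h0 h1 h2
    · exact ⟨TwoGroupPattern.twoTwoFour.map e.symm⟩
    · exact ⟨TwoGroupPattern.twoTwoFour.map
        (((AddEquiv.refl _).prodCongr AddEquiv.prodComm).trans e.symm)⟩
    · exact ⟨TwoGroupPattern.twoTwoFour.map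
        ((AddEquiv.prodAssoc.symm.trans AddEquiv.prodComm).trans e.symm)⟩
  · have h2 (i) : n i = 2 := by
      rw [Fin.prod_univ_four] at hprod
      have a0 := hn 0
      have a1 := hn 1
      have a2 := hn 2
      have a3 := hn 3
      rcases hdvd 0 with h0 | h0 | h0 | h0 <;> rcases hdvd 1 with h1 | h1 | h1 | h1 <;>
        rw [h0, h1] at hprod <;> rcases hdvd 2 with h2 | h2 | h2 | h2 <;>
        rw [h2] at hprod <;> first | omega | (fin_cases i <;> simp <;> omega)
    obtain ⟨e⟩ := nonempty_pi_fin_four_equiv n (h2 0) (h2 1) (h2 2) (h2 3)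
    exact ⟨TwoGroupPattern.twoTwoTwoTwo.map e.symm⟩

/-! ### Odd functions on groups of odd order -/

theorem eq_zero_of_neg_eq_self {G : Type*} [AddCommGroup G] (hG : Odd (Nat.card G)) {x : G}
    (hx : -x = x) : x = 0 := by
  have h2 : 2 • x = 0 := by
    rw [two_nsmul]
    nth_rewrite 1 [← hx]
    simp
  have h := Nat.dvd_gcd (addOrderOf_dvd_of_nsmul_eq_zero h2) (addOrderOf_dvd_natCard x)
  rw [Nat.coprime_two_left.2 hG, Nat.dvd_one] at h
  exact AddMonoid.addOrderOf_eq_one_iff.1 h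

theorem exists_odd_sign {Q : Type*} [AddCommGroup Q] (hQ : Odd (Nat.card Q)) :
    ∃ σ : Q → ℤ, (∀ c, σ c = 1 ∨ σ c = -1) ∧ ∀ c, c ≠ 0 → σ (-c) = -σ c := by
  have : Finite Q := Nat.finite_of_card_ne_zero hQ.pos.ne'
  obtain ⟨n, ⟨f⟩⟩ := Finite.exists_equiv_fin Q
  -- An arbitrary enumeration selects one element from each pair `c`, `-c`.
  refine ⟨fun c => if f c < f (-c) then 1 else -1, fun c => ?_, fun c hc => ?_⟩
  · dsimp only
    split_ifs <;> simp
  · have hne : f (-c) ≠ f c := fun h => hc (eq_zero_of_neg_eq_self hQ (f.injective h))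
    dsimp only
    rw [neg_neg]
    rcases lt_or_gt_of_ne hne with h | h
    · simp [h, h.not_gt]
    · simp [h, h.not_gt]

theorem exists_odd_section {O : Type*} [AddCommGroup O] (H : AddSubgroup O)
    {σ : O ⧸ H → ℤ} (hσ : ∀ c, σ c = 1 ∨ σ c = -1) (hσn : ∀ c, c ≠ 0 → σ (-c) = -σ c) :
    ∃ s : O ⧸ H → O, (∀ c, (s c : O ⧸ H) = c) ∧ ∀ c, s (-c) = -s c := by
  classical
  -- Since `σ c • c` is the same for `c` and `-c`, both use one representative, with opposite signs.
  refine ⟨fun c => if c = 0 then 0 else σ c • (σ c • c).out, fun c => ?_, fun c => ?_⟩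
  · by_cases hc : c = 0
    · simp [hc]
    · simp only [hc, if_false, QuotientAddGroup.mk_zsmul, QuotientAddGroup.out_eq']
      rcases hσ c with h | h <;> simp [h]
  · by_cases hc : c = 0
    · simp [hc]
    · simp [hc, hσn c hc]

/-! ### Reindexing and transport -/

/-- A zero-sum array family with arbitrary index types is a magic rectangle set. -/
theorem nonempty_magicRectangleSet_of_zero_sums {Γ K I J : Type*} [AddCommGroup Γ] [Fintype K]
    [Fintype I] [Fintype J] {a b c : ℕ} (hK : Nat.card K = c) (hI : Nat.card I = a)
    (hJ : Nat.card J = b) (f : K × I × J → Γ) (hf : Function.Bijective f)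
    (hrow : ∀ k i, ∑ j, f (k, i, j) = 0) (hcol : ∀ k j, ∑ i, f (k, i, j) = 0) :
    Nonempty (MagicRectangleSet Γ a b c) := by
  subst hK hI hJ
  let eK := (Finite.equivFin K).symm
  let eI := (Finite.equivFin I).symm
  let eJ := (Finite.equivFin J).symm
  refine ⟨⟨f ∘ (eK.prodCongr (eI.prodCongr eJ)), hf.comp (Equiv.bijective _), 0, 0, ?_, ?_⟩⟩
  · exact fun k i => (eJ.sum_comp fun j => f (eK k, eI i, j)).trans (hrow _ _)
  · exact fun k j => (eI.sum_comp fun i => f (eK k, i, eJ j)).trans (hcol _ _)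

theorem MagicRectangleSet.nonempty_map {Γ Γ' : Type*} [AddCommGroup Γ] [AddCommGroup Γ']
    (f : Γ ≃+ Γ') {a b c : ℕ} (h : Nonempty (MagicRectangleSet Γ a b c)) :
    Nonempty (MagicRectangleSet Γ' a b c) := by
  obtain ⟨M⟩ := h
  refine ⟨⟨f ∘ M.entry, f.bijective.comp M.entry_bijective, f M.ω, f M.δ, fun k i => ?_,
    fun k j => ?_⟩⟩
  · simp only [Function.comp_apply, ← map_sum, M.row_sum]
  · simp only [Function.comp_apply, ← map_sum, M.col_sum]

theorem colSign_eq (j : Fin 8) : colSign j = 1 ∨ colSign j = -1 := by decide +revert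

theorem rowSign_eq (i : Fin 3) (j : Fin 8) :
    rowSign i j = 0 ∨ rowSign i j = 1 ∨ rowSign i j = -1 := by decide +revert

theorem shiftCoeff_eq (i : Fin 3) (j : Fin 8) :
    shiftCoeff i j = 1 ∨ shiftCoeff i j = -1 ∨ shiftCoeff i j = 2 ∨ shiftCoeff i j = -2 := by
  decide +revert

/-! ### The arrays over `P × O` -/

section construction

variable {P O : Type*} [AddCommGroup P] [AddCommGroup O] {H : AddSubgroup O}

/-- Entries of the arrays over `P × O`: the first three rows follow the tables of the pattern, the
others come in pairs attached to opposite classes modulo `H`. -/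
def magicEntry (T : TwoGroupPattern P) (σ : O ⧸ H → ℤ) (s : O ⧸ H → O) (r : O ⧸ H) :
    (Fin 2 × H) × (Fin 3 ⊕ {c : O ⧸ H // c ≠ 0 ∧ c ≠ r ∧ c ≠ -r}) × Fin 8 → P × O
  | ((e, t), .inl i, j) => (T.p e i j, rowSign i j • s r + shiftCoeff i j • (t : O))
  | ((e, t), .inr c, j) => (colSign j • σ c • T.x e j, colSign j • (s c + σ c • (t : O)))

variable {T : TwoGroupPattern P} {σ : O ⧸ H → ℤ} {s : O ⧸ H → O} {r : O ⧸ H}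

theorem magicEntry_row_sum (k : Fin 2 × H) (i : Fin 3 ⊕ {c : O ⧸ H // c ≠ 0 ∧ c ≠ r ∧ c ≠ -r}) :
    ∑ j, magicEntry T σ s r (k, i, j) = 0 := by
  obtain ⟨e, t⟩ := k
  have hc : ∑ j, colSign j = 0 := by decide
  rcases i with i | c
  · have h1 : ∑ j, rowSign i j = 0 := by decide +revert
    have h2 : ∑ j, shiftCoeff i j = 0 := by decide +revert
    refine Prod.ext ?_ ?_
    · simpa [Prod.fst_sum, magicEntry] using T.p_row_sum e i
    · simp [Prod.snd_sum, magicEntry, Finset.sum_add_distrib, ← Finset.sum_smul, h1, h2]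
  · refine Prod.ext ?_ ?_
    · simp only [Prod.fst_sum, magicEntry, smul_comm _ (σ c), ← Finset.smul_sum, T.x_sum,
        smul_zero, Prod.fst_zero]
    · simp only [Prod.snd_sum, magicEntry, ← Finset.sum_smul, hc, zero_smul, Prod.snd_zero]

theorem magicEntry_col_sum [Finite O] [Fintype {c : O ⧸ H // c ≠ 0 ∧ c ≠ r ∧ c ≠ -r}]
    (hQ : Odd (Nat.card (O ⧸ H))) (hσn : ∀ c, c ≠ 0 → σ (-c) = -σ c)
    (hsn : ∀ c, s (-c) = -s c) (k : Fin 2 × H) (j : Fin 8) :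
    ∑ i, magicEntry T σ s r (k, i, j) = 0 := by
  obtain ⟨e, t⟩ := k
  rw [Fintype.sum_sum_type]
  have h1 : ∑ i, rowSign i j = 0 := by decide +revert
  have h2 : ∑ i, shiftCoeff i j = 0 := by decide +revert
  have hl : ∑ i, magicEntry T σ s r ((e, t), .inl i, j) = 0 := by
    refine Prod.ext ?_ ?_
    · simpa [Prod.fst_sum, magicEntry] using T.p_col_sum e j
    · simp [Prod.snd_sum, magicEntry, Finset.sum_add_distrib, ← Finset.sum_smul, h1, h2]
  rw [hl, zero_add]
  -- The rows of `c` and `-c` are negatives of each other because `σ` and `s` are odd.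
  refine Finset.sum_involution (fun c _ => ⟨-c.1, by
    obtain ⟨c, h0, h1, h2⟩ := c
    exact ⟨neg_ne_zero.2 h0, fun h => h2 (by simp [← h]), fun h => h1 (neg_injective h)⟩⟩)
    ?_ ?_ (by simp) (by simp)
  · rintro ⟨c, hc, -⟩ -
    simp [magicEntry, hσn c hc, hsn, smul_add, smul_neg, neg_smul]
    abel
  · rintro ⟨c, hc, -⟩ _ _
    refine fun h => hc (eq_zero_of_neg_eq_self hQ (congrArg Subtype.val h))

/-- The class of the second coordinate modulo `H` tells the three-row block from the paired rows. In
the block it also fixes `rowSign`, so `p_inj` recovers the position; `t` follows because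
multiplication by 1, -1, 2 or -2 is injective in odd order. In a paired row of class `d = colSign j
• c`, the first coordinate is `σ d • T.x e j`, which recovers `e` and `j`, then `c` and `t`. -/
theorem magicEntry_injective (hO : Odd (Nat.card O)) (hQ : Odd (Nat.card (O ⧸ H)))
    (hσ : ∀ c, σ c = 1 ∨ σ c = -1) (hσn : ∀ c, c ≠ 0 → σ (-c) = -σ c)
    (hs : ∀ c, (s c : O ⧸ H) = c) (hr : r ≠ 0) :
    Function.Injective (magicEntry T σ s r) := by
  have hrn : -r ≠ r := fun h => hr (eq_zero_of_neg_eq_self hQ h)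
  have hmk : ∀ t : H, ((t : O) : O ⧸ H) = 0 := fun t =>
    (QuotientAddGroup.eq_zero_iff (t : O)).2 t.2
  have hmix : ∀ (i : Fin 3) (j j' : Fin 8) (c : O ⧸ H), c ≠ 0 → c ≠ r → c ≠ -r →
      rowSign i j • r ≠ colSign j' • c := by
    intro i j j' c h0 h1 h2 h
    rcases rowSign_eq i j with h3 | h3 | h3 <;> rcases colSign_eq j' with h4 | h4 <;>
      simp only [h3, h4, zero_smul, one_smul, neg_smul] at h
    · exact h0 h.symm
    · exact h0 (neg_eq_zero.1 h.symm)
    · exact h1 h.symm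
    · exact h2 (by rw [h, neg_neg])
    · exact h2 h.symm
    · exact h1 (neg_injective h.symm)
  rintro ⟨⟨e, t⟩, i | ⟨c, hc0, hc1, hc2⟩, j⟩ ⟨⟨e', t'⟩, i' | ⟨c', hc0', hc1', hc2'⟩, j'⟩ h <;>
    obtain ⟨hp, ho⟩ := Prod.ext_iff.1 h <;> simp only [magicEntry] at hp ho <;>
    have hq := congrArg (QuotientAddGroup.mk (s := H)) ho <;>
    simp only [QuotientAddGroup.mk_add, QuotientAddGroup.mk_zsmul, hs, hmk, smul_zero,
      add_zero] at hq
  · have hsign : rowSign i j = rowSign i' j' := by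
      rcases rowSign_eq i j with h3 | h3 | h3 <;> rcases rowSign_eq i' j' with h4 | h4 | h4 <;>
        rw [h3, h4] at hq <;> simp [hr, hr.symm, hrn, hrn.symm] at hq <;> rw [h3, h4]
    obtain ⟨rfl, rfl, rfl⟩ := T.p_inj _ _ _ _ _ _ hp hsign
    have ht : (t : O) = t' := by
      have hd : shiftCoeff i j • ((t : O) - t') = 0 := by
        rw [smul_sub, sub_eq_zero]
        exact add_left_cancel ho
      rw [← sub_eq_zero]
      have h2 : ∀ x : O, (2 : ℤ) • x = 0 → x = 0 := fun x hx =>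
        eq_zero_of_neg_eq_self hO (neg_eq_of_add_eq_zero_left (by rwa [two_smul] at hx))
      rcases shiftCoeff_eq i j with h3 | h3 | h3 | h3 <;> rw [h3] at hd
      · simpa using hd
      · simpa only [neg_smul, one_smul, neg_eq_zero] using hd
      · exact h2 _ hd
      · exact h2 _ (by simpa only [neg_smul, neg_eq_zero] using hd)
    rw [Subtype.ext ht]
  · exact (hmix _ _ _ _ hc0' hc1' hc2' hq).elim
  · exact (hmix _ _ _ _ hc0 hc1 hc2 hq.symm).elim
  · have hmul : ∀ (a : Fin 8) (d : O ⧸ H), d ≠ 0 → σ (colSign a • d) = colSign a * σ d := by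
      intro a d hd
      rcases colSign_eq a with h3 | h3 <;> simp [h3, hσn d hd]
    have hτ : colSign j * σ c = colSign j' * σ c' := by
      rw [← hmul _ _ hc0, ← hmul _ _ hc0', hq]
    have hτ0 : colSign j' * σ c' = 1 ∨ colSign j' * σ c' = -1 := by
      rcases colSign_eq j' with h3 | h3 <;> rcases hσ c' with h4 | h4 <;> simp [h3, h4]
    have hxx : T.x e j = T.x e' j' := by
      rw [smul_smul, smul_smul, hτ] at hp
      rcases hτ0 with h3 | h3 <;> rw [h3] at hp <;> simpa using hp
    obtain ⟨rfl, rfl⟩ := T.x_inj _ _ _ _ hxx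
    obtain rfl : c = c' := by
      rcases colSign_eq j with h3 | h3 <;> rw [h3] at hq <;> simpa using hq
    have ht : (t : O) = t' := by
      rcases colSign_eq j with h3 | h3 <;> rcases hσ c with h4 | h4 <;> rw [h3, h4] at ho <;>
        simpa using ho
    rw [Subtype.ext ht]

end construction

theorem nonempty_magicRectangleSet_prod {P O : Type*} [AddCommGroup P] [AddCommGroup O]
    (hP : Nat.card P = 16) (T : TwoGroupPattern P) (hO : Odd (Nat.card O)) (H : AddSubgroup O)
    (hH : 1 < H.index) :
    Nonempty (MagicRectangleSet (P × O) H.index 8 (2 * Nat.card H)) := by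
  classical
  have : Finite O := Nat.finite_of_card_ne_zero hO.pos.ne'
  have : Finite P := Nat.finite_of_card_ne_zero (by rw [hP]; norm_num)
  have := Fintype.ofFinite O
  have := Fintype.ofFinite P
  have := Fintype.ofFinite (O ⧸ H)
  have := Fintype.ofFinite H
  have hmul := H.card_mul_index
  have hQ : Odd (Nat.card (O ⧸ H)) := (Nat.odd_mul.1 (hmul ▸ hO)).2
  obtain ⟨σ, hσ, hσn⟩ := exists_odd_sign hQ
  obtain ⟨s, hs, hsn⟩ := exists_odd_section H hσ hσn
  have : Nontrivial (O ⧸ H) := Finite.one_lt_card_iff_nontrivial.1 hH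
  obtain ⟨r, hr⟩ := exists_ne (0 : O ⧸ H)
  have hrn : -r ≠ r := fun h => hr (eq_zero_of_neg_eq_self hQ h)
  -- The three block rows replace the rows of the classes `0`, `r`, `-r`, which are distinct in odd
  -- order.
  have hI : Nat.card (Fin 3 ⊕ {c : O ⧸ H // c ≠ 0 ∧ c ≠ r ∧ c ≠ -r}) = H.index := by
    have h3 : ({0, r, -r} : Finset (O ⧸ H)).card = 3 :=
      Finset.card_eq_three.2 ⟨0, r, -r, hr.symm, (neg_ne_zero.2 hr).symm, hrn.symm, rfl⟩
    have := Finset.card_add_card_compl ({0, r, -r} : Finset (O ⧸ H))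
    rw [AddSubgroup.index, Nat.card_sum, Nat.card_fin, Nat.card_eq_fintype_card (α := O ⧸ H),
      ← this, h3, Nat.card_eq_fintype_card, Fintype.card_subtype]
    congr 2
    ext c
    simp
  refine nonempty_magicRectangleSet_of_zero_sums (by simp) hI (by simp) (magicEntry T σ s r)
    ?_ magicEntry_row_sum (magicEntry_col_sum hQ hσn hsn)
  rw [Nat.bijective_iff_injective_and_card]
  refine ⟨magicEntry_injective hO hQ hσ hσn hs hr, ?_⟩
  rw [Nat.card_prod, Nat.card_prod, Nat.card_prod, Nat.card_prod, hI, hP, ← hmul]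
  simp
  ring

theorem theorem1p6 (ℓ h : ℕ) (hℓ : 0 < ℓ) (Γ : Type*) [AddCommGroup Γ]
    (hΓ : Nat.card Γ = 16 * (2 * ℓ + 1) * (2 * h + 1)) :
    Nonempty (MagicRectangleSet Γ (2 * ℓ + 1) 8 (4 * h + 2)) ↔ 1 < (involutions Γ).ncard := by
  refine ⟨fun ⟨M⟩ => one_lt_ncard_involutions hΓ M, fun hinv => ?_⟩
  have : Finite Γ := Nat.finite_of_card_ne_zero (by rw [hΓ]; positivity)
  set N := (2 * ℓ + 1) * (2 * h + 1) with hN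
  have hNodd : Odd N := by
    rw [hN, Nat.odd_mul]
    exact ⟨odd_two_mul_add_one ℓ, odd_two_mul_add_one h⟩
  have hΓN : Nat.card Γ = 2 ^ 4 * N := by rw [hΓ, hN]; ring
  obtain ⟨hP, hO⟩ := card_nsmulKer_two_pow hNodd hΓN
  obtain ⟨f⟩ := nonempty_prod_nsmulKer_equiv (G := Γ) (a := 2 ^ 4) (b := N)
    ((Nat.coprime_two_left.2 hNodd).pow_left 4) (fun x => by
      rw [← hΓN]; exact card_nsmul_eq_zero')
  obtain ⟨T⟩ : Nonempty (TwoGroupPattern (nsmulKer Γ (2 ^ 4))) := by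
    refine nonempty_twoGroupPattern hP ?_
    obtain ⟨u, hu, v, hv, huv⟩ := (Set.one_lt_ncard (Set.toFinite _)).1 hinv
    have hmem : ∀ w ∈ involutions Γ, w ∈ nsmulKer Γ (2 ^ 4) := fun w hw =>
      mem_nsmulKer.2 (addOrderOf_dvd_iff_nsmul_eq_zero.1 (by
        rw [show addOrderOf w = 2 from hw]; norm_num))
    exact ⟨⟨u, hmem u hu⟩, ⟨v, hmem v hv⟩, fun h => huv (congrArg Subtype.val h),
      by rw [← AddSubgroup.addOrderOf_coe]; exact hu,
      by rw [← AddSubgroup.addOrderOf_coe]; exact hv⟩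
  obtain ⟨H, hH⟩ := AddCommGroup.exists_addSubgroup_card (2 * h + 1)
    (O := nsmulKer Γ N) (by rw [hO]; exact dvd_mul_left _ _)
  have hidx : H.index = 2 * ℓ + 1 := by
    have := H.card_mul_index
    rw [hH, hO] at this
    exact Nat.eq_of_mul_eq_mul_left (by positivity) (this.trans (hN.trans (mul_comm _ _)))
  -- Here `ℓ ≥ 1` enters: the index exceeds one, so a nonzero class `r` exists.
  have M := nonempty_magicRectangleSet_prod hP T (by rwa [hO]) H (by omega)
  rw [hidx, hH, show 2 * (2 * h + 1) = 4 * h + 2 by ring] at M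
  exact MagicRectangleSet.nonempty_map f M
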